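/- Let $\mathbb X$ be a finite set, let $f:\mathbb X\to\mathbb R$ be drawn from a Gaussian process prior with arbitrary mean and covariance functions, and let $g\mapsto\mathcal O_{\mathcal A}(g)\subseteq\mathbb X$ be a (measurable) target set defined for all $g:\mathbb X\to\mathbb R$. Assume that it is complement-independent: for all $g,g':\mathbb X\to\mathbb R$, if there is a set $S\supseteq\mathcal O_{\mathcal A}(g)\cup\mathcal O_{\mathcal A}(g')$ with $g(x)=g'(x)$ for all $x\in S$, then $\mathcal O_{\mathcal A}(g)=\mathcal O_{\mathcal A}(g')$. Observations have the form $y_n=f(x_n)+\epsilon_n$, where the $\epsilon_n$ are i.i.d. $\mathcal N(0,\sigma^2)$ with $\sigma^2\ge 0$, each $\epsilon_n$ being independent of $f$ and of everything that precedes its observation. Let $\mathcal D_0$ be a finite (possibly empty) initial dataset of such observations, at points chosen independently of $f$, and let $\mathcal D_n=\mathcal D_{n-1}\cup\{(x_n,y_n)\}$. Suppose that the points $x_1,x_2,\dots$ are chosen by PS-BAX: at iteration $n$ a function $\tilde f_n$ is drawn afresh from the posterior distribution of $f$ given $\mathcal D_{n-1}$, one sets $X_n=\mathcal O_{\mathcal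 A}(\tilde f_n)$, and $x_n\in\operatorname{arg\,max}_{x\in X_n}\sigma_{n}(x)$, where $\sigma_{n}(x)$ is the posterior standard deviation of $f(x)$ given $\mathcal D_{n-1}$. Ties are broken in any way, possibly at random, that uses only the past of the algorithm and $\tilde f_n$; if $X_n=\emptyset$, then $x_n$ is any point of $\mathbb X$ chosen in such a way. For each $n$ let $\mathbf P_n$ be the conditional probability given $\mathcal D_{n-1}$, and let $T_n$ be a maximum a posteriori target set, that is, $T_n\in\operatorname{arg\,max}_{X\subseteq\mathbb X}\mathbf P_n(\mathcal O_{\mathcal A}(f)=X)$. Then, almost surely, $T_n=\mathcal O_{\mathcal A}(f)$ for all sufficiently large $n$. -/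

import Mathlib

open MeasureTheory ProbabilityTheory Filter
open scoped NNReal ENNReal

/-- A target set `O : (𝕏 → ℝ) → Set 𝕏` is complement-independent if `O g = O g'` whenever `g` and
`g'` agree on some set `S` containing both `O g` and `O g'`. -/
def ComplementIndependent {𝕏 : Type*} (O : (𝕏 → ℝ) → Set 𝕏) : Prop :=
  ∀ g g' : 𝕏 → ℝ, (∃ S : Set 𝕏, O g ∪ O g' ⊆ S ∧ ∀ x ∈ S, g x = g' x) → O g = O g'

/-- A dataset: `m` initial pairs `(x, y)` followed by `n` pairs collected sequentially. -/
abbrev Dataset (𝕏 : Type*) (m n : ℕ) : Type _ :=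
  (Fin m → 𝕏 × ℝ) × (Fin n → 𝕏 × ℝ)

/-- Everything the algorithm has seen before iteration `n` (iterations are numbered `0, 1, …`):
the initial dataset and, for each past iteration, the sampled function, the evaluation point and
the observed value. -/
abbrev History (𝕏 : Type*) (m n : ℕ) : Type _ :=
  (Fin m → 𝕏 × ℝ) × (Fin n → (𝕏 → ℝ) × 𝕏 × ℝ)

/-- The dataset contained in a history (the sampled functions are forgotten). -/
def History.toDataset {𝕏 : Type*} {m n : ℕ} (h : History 𝕏 m n) : Dataset 𝕏 m n :=
  (h.1, fun k => (h.2 k).2)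

theorem History.measurable_toDataset {𝕏 : Type*} [MeasurableSpace 𝕏] {m n : ℕ} :
    Measurable (History.toDataset : History 𝕏 m n → Dataset 𝕏 m n) := by
  unfold History.toDataset
  fun_prop

/-- The random quantities appearing in a run of a sequential sampling algorithm: the unknown
function `f`, the `m` initial points and noises, and for every iteration `n` the sampled function
`fs n`, the evaluation point `x n` and the observation noise `ε n`. -/
structure BAXProcess (Ω 𝕏 : Type*) (m : ℕ) where
  f : Ω → 𝕏 → ℝ
  x₀ : Ω → Fin m → 𝕏
  ε₀ : Ω → Fin m → ℝ
  fs : ℕ → Ω → 𝕏 → ℝ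
  x : ℕ → Ω → 𝕏
  ε : ℕ → Ω → ℝ

namespace BAXProcess

/-- The noisy observation at iteration `n`. -/
def y {Ω 𝕏 : Type*} {m : ℕ} (A : BAXProcess Ω 𝕏 m) (n : ℕ) (ω : Ω) : ℝ :=
  A.f ω (A.x n ω) + A.ε n ω

/-- The initial dataset. -/
def initData {Ω 𝕏 : Type*} {m : ℕ} (A : BAXProcess Ω 𝕏 m) (ω : Ω) : Fin m → 𝕏 × ℝ :=
  fun i => (A.x₀ ω i, A.f ω (A.x₀ ω i) + A.ε₀ ω i)

/-- What the algorithm has seen after `n` iterations. -/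
def history {Ω 𝕏 : Type*} {m : ℕ} (A : BAXProcess Ω 𝕏 m) (n : ℕ) (ω : Ω) : History 𝕏 m n :=
  (A.initData ω, fun k => (A.fs k ω, A.x k ω, A.y k ω))

/-- The dataset after `n` iterations. -/
def data {Ω 𝕏 : Type*} {m : ℕ} (A : BAXProcess Ω 𝕏 m) (n : ℕ) (ω : Ω) : Dataset 𝕏 m n :=
  (A.history n ω).toDataset

/-- The posterior after `n` iterations: the regular conditional distribution of `f` given the
dataset, as a kernel from datasets to functions. -/
noncomputable def posterior {Ω 𝕏 : Type*} [MeasurableSpace Ω] [Finite 𝕏] [MeasurableSpace 𝕏]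
    {m : ℕ} (A : BAXProcess Ω 𝕏 m) (P : Measure Ω) [IsProbabilityMeasure P] (n : ℕ) :
    Kernel (Dataset 𝕏 m n) (𝕏 → ℝ) :=
  condDistrib A.f (A.data n) P

instance instIsMarkovKernelPosterior {Ω 𝕏 : Type*} [MeasurableSpace Ω] [Finite 𝕏]
    [MeasurableSpace 𝕏] {m : ℕ} (A : BAXProcess Ω 𝕏 m) (P : Measure Ω) [IsProbabilityMeasure P]
    (n : ℕ) : IsMarkovKernel (A.posterior P n) := by
  unfold posterior
  infer_instance

/-- The posterior probability, after `n` iterations, that the target set equals `X`. -/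
noncomputable def targetProb {Ω 𝕏 : Type*} [MeasurableSpace Ω] [Finite 𝕏] [MeasurableSpace 𝕏]
    {m : ℕ} (A : BAXProcess Ω 𝕏 m) (P : Measure Ω) [IsProbabilityMeasure P]
    (O : (𝕏 → ℝ) → Set 𝕏) (n : ℕ) (ω : Ω) (X : Set 𝕏) : ℝ≥0∞ :=
  A.posterior P n (A.data n ω) {g | O g = X}

/-- The posterior standard deviation of `f x` after `n` iterations. -/
noncomputable def posteriorSD {Ω 𝕏 : Type*} [MeasurableSpace Ω] [Finite 𝕏] [MeasurableSpace 𝕏]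
    {m : ℕ} (A : BAXProcess Ω 𝕏 m) (P : Measure Ω) [IsProbabilityMeasure P]
    (n : ℕ) (ω : Ω) (x : 𝕏) : ℝ :=
  Real.sqrt (variance (fun g : 𝕏 → ℝ => g x) (A.posterior P n (A.data n ω)))

/-- `A` is a run of PS-BAX for the target set `O`, with a Gaussian process prior and Gaussian
observation noise of variance `v ≥ 0`. -/
structure IsPSBAX {Ω 𝕏 : Type*} [MeasurableSpace Ω] [Finite 𝕏] [MeasurableSpace 𝕏] {m : ℕ}
    (A : BAXProcess Ω 𝕏 m) (P : Measure Ω) [IsProbabilityMeasure P]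
    (O : (𝕏 → ℝ) → Set 𝕏) (v : ℝ≥0) : Prop where
  measurable_f : Measurable A.f
  measurable_x₀ : Measurable A.x₀
  measurable_ε₀ : Measurable A.ε₀
  measurable_fs : ∀ n, Measurable (A.fs n)
  measurable_x : ∀ n, Measurable (A.x n)
  measurable_ε : ∀ n, Measurable (A.ε n)
  /-- The prior of `f` is a Gaussian process, with arbitrary mean and covariance. -/
  prior : IsGaussianProcess (fun x ω => A.f ω x) P
  /-- The initial points are chosen without knowledge of `f`. -/
  init_indep : IndepFun A.x₀ A.f P
  /-- The initial noises are i.i.d. centred Gaussian and independent of `f` and of the points. -/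
  init_noise_law : HasLaw A.ε₀ (Measure.pi fun _ => gaussianReal 0 v) P
  init_noise_indep : IndepFun A.ε₀ (fun ω => (A.f ω, A.x₀ ω)) P
  /-- Given `f` and the history, the sampled function is a draw from the posterior given the
  current dataset. -/
  sampling : ∀ n, HasCondDistrib (A.fs n) (fun ω => (A.f ω, A.history n ω))
    (Kernel.prodMkLeft (𝕏 → ℝ)
      ((A.posterior P n).comap History.toDataset History.measurable_toDataset)) P
  /-- The evaluation point is chosen (possibly with randomized tie-breaking) on the basis of the
  history and of the current sample only. -/
  selection : ∀ n, ∃ κ : Kernel (History 𝕏 m n × (𝕏 → ℝ)) 𝕏, IsMarkovKernel κ ∧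
    HasCondDistrib (A.x n) (fun ω => (A.f ω, A.history n ω, A.fs n ω))
      (Kernel.prodMkLeft (𝕏 → ℝ) κ) P
  /-- The evaluation point has the largest posterior standard deviation in the sampled target set;
  it is unconstrained if that set is empty. -/
  argmax : ∀ n, ∀ᵐ ω ∂P, (O (A.fs n ω)).Nonempty →
    A.x n ω ∈ O (A.fs n ω) ∧
      ∀ x' ∈ O (A.fs n ω), A.posteriorSD P n ω x' ≤ A.posteriorSD P n ω (A.x n ω)
  /-- The noise is centred Gaussian and independent of everything that precedes it; in particular
  the noises are i.i.d. and independent of `f`. -/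
  noise_law : ∀ n, HasLaw (A.ε n) (gaussianReal 0 v) P
  noise_indep : ∀ n,
    IndepFun (A.ε n) (fun ω => (A.f ω, A.history n ω, A.fs n ω, A.x n ω)) P

end BAXProcess

/-! By Lévy's upward theorem the posterior probabilities and variances converge almost surely to
those of the limiting posterior, the conditional law of `f` given `allData`.

A point evaluated infinitely often has zero limiting variance (`variance_eq_zero_of_frequently`):
the mean of its first `j` observations predicts `f x` with mean-square error at most `v / j`. A
target set `Y` of positive limiting probability is sampled infinitely often (`frequently_sample`,
conditional Borel–Cantelli). At those times the evaluated point has the largest deviation in `Y`. As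
`𝕏` is finite, one maximiser recurs, so its limiting variance is zero, and hence so is that of every
point of `Y` (`variance_eq_zero_of_frequently_mem`).

If two target sets have positive limiting probability, functions realising them can be chosen equal
to the posterior mean on both sets, and complement-independence makes the sets equal. The set `O f`
almost surely has positive limiting probability (`ae_limit_prob_ne_zero`), so every other set has
limit zero and eventually loses the maximisation. -/

/-! ### Conditional variance and mean-square prediction. -/

section Conditioning

variable {Ω β E : Type*} {mΩ : MeasurableSpace Ω} {mβ : MeasurableSpace β} [MeasurableSpace E]
  [StandardBorelSpace E] [Nonempty E] {P : Measure Ω} [IsProbabilityMeasure P]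

theorem ae_memLp_condDistrib {X : Ω → β} {Y : Ω → E} (hX : Measurable X) (hY : Measurable Y)
    {φ : E → ℝ} (hφ : Measurable φ) (hL : MemLp (fun ω => φ (Y ω)) 2 P) :
    ∀ᵐ ω ∂P, MemLp φ 2 (condDistrib Y X P (X ω)) := by
  have hint : Integrable (fun p : β × E => φ p.2 ^ 2) (P.map fun ω => (X ω, Y ω)) := by
    have hm : Measurable fun p : β × E => φ p.2 ^ 2 := (hφ.comp measurable_snd).pow_const 2
    rw [integrable_map_measure hm.aestronglyMeasurable
      (hX.prodMk hY).aemeasurable]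
    exact hL.integrable_sq
  filter_upwards [hint.condDistrib_ae hX.aemeasurable hY.aemeasurable] with ω hω
  exact (memLp_two_iff_integrable_sq hφ.aestronglyMeasurable).2 hω

/-- Writing the variance through two conditional expectations makes it accessible to martingale
convergence. -/
theorem variance_condDistrib_ae_eq {X : Ω → β} {Y : Ω → E} (hX : Measurable X) (hY : Measurable Y)
    {φ : E → ℝ} (hφ : Measurable φ) (hL : MemLp (fun ω => φ (Y ω)) 2 P) :
    ∀ᵐ ω ∂P, Var[φ; condDistrib Y X P (X ω)] =
      (P[fun ω => φ (Y ω) ^ 2 | mβ.comap X]) ω - (P[fun ω => φ (Y ω) | mβ.comap X]) ω ^ 2 := by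
  filter_upwards [ae_memLp_condDistrib hX hY hφ hL,
    condExp_ae_eq_integral_condDistrib hX hY.aemeasurable (f := fun e => φ e ^ 2)
      (hφ.pow_const 2).stronglyMeasurable hL.integrable_sq,
    condExp_ae_eq_integral_condDistrib hX hY.aemeasurable hφ.stronglyMeasurable
      (hL.integrable one_le_two)] with ω h1 h2 h3
  rw [variance_eq_sub h1, h2, h3]
  rfl

theorem aemeasurable_variance_condDistrib {X : Ω → β} {Y : Ω → E} (hX : Measurable X)
    (hY : Measurable Y) {φ : E → ℝ} (hφ : Measurable φ) (hL : MemLp (fun ω => φ (Y ω)) 2 P) :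
    AEMeasurable (fun ω => Var[φ; condDistrib Y X P (X ω)]) P := by
  refine AEMeasurable.congr ?_ (EventuallyEq.symm (variance_condDistrib_ae_eq hX hY hφ hL))
  exact (integrable_condExp.aestronglyMeasurable.aemeasurable).sub
    (integrable_condExp.aestronglyMeasurable.aemeasurable.pow_const 2)

/-- The conditional mean is the best predictor in mean square. -/
theorem setLIntegral_variance_condDistrib_le {X : Ω → β} {Y : Ω → E} (hX : Measurable X)
    (hY : Measurable Y) {φ : E → ℝ} (hφ : Measurable φ) (hL : MemLp (fun ω => φ (Y ω)) 2 P)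
    {B : Set β} (hB : MeasurableSet B) {Z : β → ℝ} (hZ : Measurable Z) :
    ∫⁻ ω in X ⁻¹' B, ENNReal.ofReal Var[φ; condDistrib Y X P (X ω)] ∂P ≤
      ∫⁻ ω in X ⁻¹' B, ENNReal.ofReal ((φ (Y ω) - Z (X ω)) ^ 2) ∂P := by
  set κ := condDistrib Y X P with hκ
  have hF : Measurable fun p : β × E => ENNReal.ofReal ((φ p.2 - Z p.1) ^ 2) := by fun_prop
  have hF' : Measurable (B.indicator
      fun b => ∫⁻ e, ENNReal.ofReal ((φ e - Z b) ^ 2) ∂κ b) :=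
    (hF.lintegral_kernel_prod_right' (κ := κ)).indicator hB
  calc ∫⁻ ω in X ⁻¹' B, ENNReal.ofReal Var[φ; κ (X ω)] ∂P
      ≤ ∫⁻ ω in X ⁻¹' B, ∫⁻ e, ENNReal.ofReal ((φ e - Z (X ω)) ^ 2) ∂κ (X ω) ∂P := by
        refine lintegral_mono_ae (ae_restrict_of_ae ?_)
        filter_upwards [ae_memLp_condDistrib hX hY hφ hL] with ω hω
        have hm : MemLp (fun e => φ e - Z (X ω)) 2 (κ (X ω)) := hω.sub (memLp_const _)
        -- Shifting by the constant `Z (X ω)` keeps the variance, which is at most the second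
        -- moment.
        rw [← variance_sub_const hω.aestronglyMeasurable (Z (X ω)),
          ← ofReal_integral_eq_lintegral_ofReal hm.integrable_sq
            (ae_of_all _ fun _ => sq_nonneg _)]
        exact ENNReal.ofReal_le_ofReal (variance_le_expectation_sq hm.aestronglyMeasurable)
    _ = ∫⁻ b, B.indicator (fun b => ∫⁻ e, ENNReal.ofReal ((φ e - Z b) ^ 2) ∂κ b) b
          ∂(P.map X) := by
        rw [lintegral_map hF' hX, ← lintegral_indicator (hX hB)]
        rfl
    _ = ∫⁻ p, (B ×ˢ Set.univ).indicator (fun p : β × E => ENNReal.ofReal ((φ p.2 - Z p.1) ^ 2)) p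
          ∂((P.map X) ⊗ₘ κ) := by
        rw [Measure.lintegral_compProd (hF.indicator (hB.prod MeasurableSet.univ))]
        refine lintegral_congr fun b => ?_
        by_cases hb : b ∈ B <;> simp [hb, Set.indicator]
    _ = _ := by
        rw [hκ, compProd_map_condDistrib hY.aemeasurable,
          lintegral_map (hF.indicator (hB.prod MeasurableSet.univ)) (hX.prodMk hY),
          ← lintegral_indicator (hX hB)]
        refine lintegral_congr fun ω => ?_
        by_cases hb : X ω ∈ B <;> simp [hb, Set.indicator]

end Conditioning

/-! ### Martingale convergence and conditional Borel–Cantelli. -/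

section Levy

variable {Ω β E : Type*} {γ : ℕ → Type*} {mΩ : MeasurableSpace Ω} {mβ : MeasurableSpace β}
  {mγ : ∀ n, MeasurableSpace (γ n)} [MeasurableSpace E]
  [StandardBorelSpace E] [Nonempty E] {P : Measure Ω} [IsProbabilityMeasure P]

theorem tendsto_condExp_comap {X : Ω → β} {D : ∀ n, Ω → γ n} (hD : ∀ n, Measurable (D n))
    (hmono : Monotone fun n => (mγ n).comap (D n))
    (hsup : ⨆ n, (mγ n).comap (D n) = mβ.comap X) (g : Ω → ℝ) :
    ∀ᵐ ω ∂P, Tendsto (fun n => (P[g | (mγ n).comap (D n)]) ω) atTop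
      (nhds ((P[g | mβ.comap X]) ω)) := by
  let ℱ : Filtration ℕ mΩ := ⟨fun n => (mγ n).comap (D n), hmono, fun n => (hD n).comap_le⟩
  have := tendsto_ae_condExp (ℱ := ℱ) (μ := P) g
  rw [← hsup]
  exact this

theorem tendsto_condDistrib_apply {X : Ω → β} {D : ∀ n, Ω → γ n} {Y : Ω → E} (hX : Measurable X)
    (hD : ∀ n, Measurable (D n)) (hY : Measurable Y)
    (hmono : Monotone fun n => (mγ n).comap (D n))
    (hsup : ⨆ n, (mγ n).comap (D n) = mβ.comap X) {s : Set E} (hs : MeasurableSet s) :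
    ∀ᵐ ω ∂P, Tendsto (fun n => (condDistrib Y (D n) P (D n ω)).real s) atTop
      (nhds ((condDistrib Y X P (X ω)).real s)) := by
  filter_upwards [condDistrib_ae_eq_condExp (μ := P) hX hY hs,
    ae_all_iff.2 fun n => condDistrib_ae_eq_condExp (μ := P) (hD n) hY hs,
    tendsto_condExp_comap (P := P) hD hmono hsup ((Y ⁻¹' s).indicator fun _ => (1 : ℝ))]
    with ω h1 h2 h3
  rw [h1]
  exact h3.congr fun n => (h2 n).symm

theorem tendsto_variance_condDistrib {X : Ω → β} {D : ∀ n, Ω → γ n} {Y : Ω → E}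
    (hX : Measurable X) (hD : ∀ n, Measurable (D n)) (hY : Measurable Y)
    (hmono : Monotone fun n => (mγ n).comap (D n))
    (hsup : ⨆ n, (mγ n).comap (D n) = mβ.comap X) {φ : E → ℝ} (hφ : Measurable φ)
    (hL : MemLp (fun ω => φ (Y ω)) 2 P) :
    ∀ᵐ ω ∂P, Tendsto (fun n => Var[φ; condDistrib Y (D n) P (D n ω)]) atTop
      (nhds Var[φ; condDistrib Y X P (X ω)]) := by
  filter_upwards [variance_condDistrib_ae_eq hX hY hφ hL,
    ae_all_iff.2 fun n => variance_condDistrib_ae_eq (hD n) hY hφ hL,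
    tendsto_condExp_comap (P := P) hD hmono hsup fun ω => φ (Y ω) ^ 2,
    tendsto_condExp_comap (P := P) hD hmono hsup fun ω => φ (Y ω)] with ω h1 h2 h3 h4
  rw [h1]
  exact (h3.sub (h4.pow 2)).congr fun n => (h2 n).symm

/-- Conditional Borel–Cantelli: if `F n` is drawn from the kernel `κ n` given `D n`, then almost
surely a set visited finitely often has conditional probabilities tending to zero. -/
theorem tendsto_zero_of_eventually_notMem {D : ∀ n, Ω → γ n} {F : ℕ → Ω → E}
    {κ : ∀ n, Kernel (γ n) E} [∀ n, IsMarkovKernel (κ n)] (hD : ∀ n, Measurable (D n))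
    (hF : ∀ n, Measurable (F n)) (hmono : Monotone fun n => (mγ n).comap (D n))
    (hFD : ∀ n, Measurable[(mγ (n + 1)).comap (D (n + 1))] (F n))
    (hκ : ∀ n, HasCondDistrib (F n) (D n) (κ n) P) {s : Set E} (hs : MeasurableSet s) :
    ∀ᵐ ω ∂P, (∀ᶠ n in atTop, F n ω ∉ s) →
      Tendsto (fun n => (κ n (D n ω)).real s) atTop (nhds 0) := by
  let ℱ : Filtration ℕ mΩ := ⟨fun n => (mγ n).comap (D n), hmono, fun n => (hD n).comap_le⟩
  -- `F k` is known only at time `k + 1`, hence the shift, with `∅` at time 0.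
  let A : ℕ → Set Ω := fun n => Nat.casesOn n ∅ fun k => F k ⁻¹' s
  have hA : ∀ n, MeasurableSet[ℱ n] (A n) := by
    rintro (_ | k)
    · exact @MeasurableSet.empty _ (ℱ 0)
    · exact hFD k hs
  have hcond : ∀ n, ∀ᵐ ω ∂P,
      (P[(A (n + 1)).indicator (1 : Ω → ℝ) | ℱ n]) ω = (κ n (D n ω)).real s := by
    intro n
    have h1 := condDistrib_ae_eq_condExp (μ := P) (hD n) (hF n) hs
    have h2 : condDistrib (F n) (D n) P =ᵐ[P.map (D n)] κ n :=
      condDistrib_ae_eq_of_measure_eq_compProd (D n) (hF n).aemeasurable (hκ n).map_eq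
    filter_upwards [h1, ae_of_ae_map (hD n).aemeasurable h2] with ω h1 h2
    rw [← h2, h1]
    rfl
  filter_upwards [ae_mem_limsup_atTop_iff (ℱ := ℱ) P hA, ae_all_iff.2 hcond] with ω h1 h2 h3
  have hnot : ω ∉ limsup A atTop := by
    rw [Filter.mem_limsup_iff_frequently_mem, Filter.not_frequently]
    obtain ⟨N, hN⟩ := eventually_atTop.1 h3
    refine eventually_atTop.2 ⟨N + 1, fun n hn => ?_⟩
    obtain ⟨k, rfl⟩ : ∃ k, n = k + 1 := ⟨n - 1, by omega⟩
    exact hN k (by omega)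
  rw [h1] at hnot
  simp only [h2] at hnot
  -- Finitely many visits make the conditional probabilities summable.
  rw [← summable_iff_not_tendsto_nat_atTop_of_nonneg (fun n => measureReal_nonneg)] at hnot
  exact hnot.tendsto_atTop_zero

end Levy

/-! ### Orthogonality of predictably weighted noises. -/

section Noise

variable {Ω : Type*} {mΩ : MeasurableSpace Ω} {P : Measure Ω}

theorem memLp_two_weighted_sum {ε w : ℕ → Ω → ℝ} (hε : ∀ n, MemLp (ε n) 2 P)
    (hw : ∀ n, Measurable (w n)) (hw1 : ∀ n ω, |w n ω| ≤ 1) (n : ℕ) :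
    MemLp (fun ω => ∑ k ∈ Finset.range n, w k ω * ε k ω) 2 P := by
  refine memLp_finsetSum _ fun k _ => (hε k).mono
    ((hw k).aestronglyMeasurable.mul (hε k).aestronglyMeasurable) (ae_of_all _ fun ω => ?_)
  rw [norm_mul]
  exact mul_le_of_le_one_left (norm_nonneg _) (hw1 k ω)

/-- The second moment of a predictably weighted sum of centred noises. -/
theorem integral_sq_weighted_sum [IsProbabilityMeasure P] {ε w : ℕ → Ω → ℝ} {v : ℝ} (hε : ∀ n, MemLp (ε n) 2 P)
    (hmean : ∀ n, ∫ ω, ε n ω ∂P = 0) (hvar : ∀ n, ∫ ω, ε n ω ^ 2 ∂P = v)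
    (hw : ∀ n, Measurable (w n)) (hw1 : ∀ n ω, |w n ω| ≤ 1)
    (hindep : ∀ n, IndepFun (fun ω => (∑ k ∈ Finset.range n, w k ω * ε k ω, w n ω)) (ε n) P)
    (n : ℕ) :
    ∫ ω, (∑ k ∈ Finset.range n, w k ω * ε k ω) ^ 2 ∂P =
      v * ∫ ω, ∑ k ∈ Finset.range n, w k ω ^ 2 ∂P := by
  have hw2 : ∀ n, Integrable (fun ω => w n ω ^ 2) P := fun n =>
    Integrable.of_bound (by fun_prop) 1 (ae_of_all _ fun ω => by
      rw [norm_pow]; exact pow_le_one₀ (norm_nonneg _) (hw1 n ω))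
  induction n with
  | zero => simp
  | succ n ih =>
    have hM := memLp_two_weighted_sum hε hw hw1 n
    have hwε : MemLp (fun ω => w n ω * ε n ω) 2 P := (hε n).mono
      ((hw n).aestronglyMeasurable.mul (hε n).aestronglyMeasurable) (ae_of_all _ fun ω => by
        rw [norm_mul]; exact mul_le_of_le_one_left (norm_nonneg _) (hw1 n ω))
    -- The fresh noise is centred and independent of the earlier sum and of its own weight.
    have hcross : ∫ ω, (∑ k ∈ Finset.range n, w k ω * ε k ω) * (w n ω * ε n ω) ∂P = 0 := by
      have hi : IndepFun (fun ω => (∑ k ∈ Finset.range n, w k ω * ε k ω) * w n ω) (ε n) P :=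
        (hindep n).comp (φ := fun p : ℝ × ℝ => p.1 * p.2) (ψ := id) (by fun_prop) measurable_id
      have := hi.integral_mul_eq_mul_integral
        (hM.aestronglyMeasurable.mul (hw n).aestronglyMeasurable) (hε n).aestronglyMeasurable
      simp only [hmean, mul_zero] at this
      rw [← this]
      exact integral_congr_ae (ae_of_all _ fun ω => by simp [mul_assoc])
    have hlast : ∫ ω, (w n ω * ε n ω) ^ 2 ∂P = v * ∫ ω, w n ω ^ 2 ∂P := by
      have hi : IndepFun (fun ω => w n ω ^ 2) (fun ω => ε n ω ^ 2) P :=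
        (hindep n).comp (φ := fun p : ℝ × ℝ => p.2 ^ 2) (ψ := fun x => x ^ 2) (by fun_prop)
          (by fun_prop)
      have := hi.integral_mul_eq_mul_integral
        (hw2 n).aestronglyMeasurable (hε n).integrable_sq.aestronglyMeasurable
      rw [hvar] at this
      rw [mul_comm v, ← this]
      exact integral_congr_ae (ae_of_all _ fun ω => by simp [mul_pow])
    have hsplit : ∀ ω, (∑ k ∈ Finset.range (n + 1), w k ω * ε k ω) ^ 2 =
        ((∑ k ∈ Finset.range n, w k ω * ε k ω) ^ 2 +
          2 * ((∑ k ∈ Finset.range n, w k ω * ε k ω) * (w n ω * ε n ω))) +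
          (w n ω * ε n ω) ^ 2 := fun ω => by rw [Finset.sum_range_succ]; ring
    have hMi := hM.integrable_sq
    have hci : Integrable (fun ω => 2 *
        ((∑ k ∈ Finset.range n, w k ω * ε k ω) * (w n ω * ε n ω))) P :=
      (hM.integrable_mul hwε).const_mul 2
    have hsq : ∀ ω, ∑ k ∈ Finset.range (n + 1), w k ω ^ 2 =
        ∑ k ∈ Finset.range n, w k ω ^ 2 + w n ω ^ 2 := fun ω => Finset.sum_range_succ _ n
    simp only [hsplit, hsq]
    have hsum : Integrable (fun ω => (∑ k ∈ Finset.range n, w k ω * ε k ω) ^ 2 +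
        2 * ((∑ k ∈ Finset.range n, w k ω * ε k ω) * (w n ω * ε n ω))) P := hMi.add hci
    rw [integral_add hsum hwε.integrable_sq, integral_add hMi hci, integral_const_mul,
      hcross, ih, hlast, integral_add (integrable_finsetSum _ fun k _ => hw2 k) (hw2 n)]
    ring

end Noise

/-! ### Counting visits to a point. -/

section Visits

variable {𝕏 : Type*}

open Classical in
/-- The number of visits to `x` of the sequence `a` before time `n`. -/
noncomputable def visits (a : ℕ → 𝕏) (x : 𝕏) (n : ℕ) : ℕ :=
  ∑ k ∈ Finset.range n, if a k = x then 1 else 0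

open Classical in
/-- The indicator that time `k` is one of the first `j` visits of `a` to `x`. -/
noncomputable def earlyVisit (a : ℕ → 𝕏) (x : 𝕏) (j k : ℕ) : ℝ :=
  if a k = x ∧ visits a x k < j then 1 else 0

theorem visits_succ_of_eq {a : ℕ → 𝕏} {x : 𝕏} {n : ℕ} (h : a n = x) :
    visits a x (n + 1) = visits a x n + 1 := by
  rw [visits, visits, Finset.sum_range_succ, if_pos h]

theorem visits_succ_of_ne {a : ℕ → 𝕏} {x : 𝕏} {n : ℕ} (h : a n ≠ x) :
    visits a x (n + 1) = visits a x n := by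
  rw [visits, visits, Finset.sum_range_succ, if_neg h, add_zero]

theorem monotone_visits (a : ℕ → 𝕏) (x : 𝕏) : Monotone (visits a x) := by
  refine monotone_nat_of_le_succ fun n => ?_
  by_cases h : a n = x
  · simp [visits_succ_of_eq h]
  · simp [visits_succ_of_ne h]

theorem exists_le_visits {a : ℕ → 𝕏} {x : 𝕏} (h : ∃ᶠ n in atTop, a n = x) (j : ℕ) :
    ∃ n, j ≤ visits a x n := by
  induction j with
  | zero => exact ⟨0, Nat.zero_le _⟩
  | succ j ih =>
    obtain ⟨n, hn⟩ := ih
    obtain ⟨k, hk, hak⟩ := frequently_atTop.1 h n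
    refine ⟨k + 1, ?_⟩
    rw [visits_succ_of_eq hak]
    exact Nat.succ_le_succ (hn.trans (monotone_visits a x hk))

/-- After `j` visits the weights sum to exactly `j`, so the weighted mean of the observations is
unbiased pathwise up to noise. -/
theorem sum_earlyVisit (a : ℕ → 𝕏) (x : 𝕏) (j n : ℕ) :
    ∑ k ∈ Finset.range n, earlyVisit a x j k = (min (visits a x n) j : ℕ) := by
  induction n with
  | zero => simp [visits]
  | succ n ih =>
    rw [Finset.sum_range_succ, ih]
    by_cases h : a n = x
    · rw [visits_succ_of_eq h]
      by_cases h' : visits a x n < j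
      · rw [earlyVisit, if_pos ⟨h, h'⟩, min_eq_left h'.le, min_eq_left h']
        push_cast
        rfl
      · rw [earlyVisit, if_neg (fun h'' => h' h''.2), min_eq_right (not_lt.1 h'),
          min_eq_right (by omega), add_zero]
    · rw [visits_succ_of_ne h, earlyVisit, if_neg (fun h'' => h h''.1), add_zero]

theorem abs_earlyVisit_le (a : ℕ → 𝕏) (x : 𝕏) (j k : ℕ) : |earlyVisit a x j k| ≤ 1 := by
  unfold earlyVisit
  split_ifs <;> simp

theorem earlyVisit_sq (a : ℕ → 𝕏) (x : 𝕏) (j k : ℕ) :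
    earlyVisit a x j k ^ 2 = earlyVisit a x j k := by
  unfold earlyVisit
  split_ifs <;> simp

theorem earlyVisit_mul_eq (a : ℕ → 𝕏) (x : 𝕏) (j k : ℕ) (g : 𝕏 → ℝ) :
    earlyVisit a x j k * g (a k) = earlyVisit a x j k * g x := by
  unfold earlyVisit
  split_ifs with h
  · rw [h.1]
  · simp

variable [MeasurableSpace 𝕏] [MeasurableSingletonClass 𝕏] {Ω : Type*} {mΩ : MeasurableSpace Ω}

theorem measurable_visits {a : ℕ → Ω → 𝕏} {n : ℕ} (ha : ∀ k < n, Measurable (a k)) (x : 𝕏) :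
    Measurable fun ω => visits (fun k => a k ω) x n := by
  classical
  unfold visits
  refine Finset.measurable_sum _ fun k hk => ?_
  refine Measurable.ite ?_ measurable_const measurable_const
  exact ha k (Finset.mem_range.1 hk) (measurableSet_singleton x)

theorem measurable_earlyVisit {a : ℕ → Ω → 𝕏} {k : ℕ} (ha : ∀ i ≤ k, Measurable (a i)) (x : 𝕏)
    (j : ℕ) : Measurable fun ω => earlyVisit (fun i => a i ω) x j k := by
  classical
  unfold earlyVisit
  refine Measurable.ite (MeasurableSet.inter ?_ ?_) measurable_const measurable_const
  · exact ha k le_rfl (measurableSet_singleton x)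
  · exact measurableSet_lt (measurable_visits (fun i hi => ha i hi.le) x) measurable_const

theorem Measurable.eval_at [Finite 𝕏] {f : Ω → 𝕏 → ℝ} {a : Ω → 𝕏} (hf : Measurable f)
    (ha : Measurable a) : Measurable fun ω => f ω (a ω) := by
  have h : Measurable fun p : (𝕏 → ℝ) × 𝕏 => p.1 p.2 :=
    measurable_from_prod_countable_left fun x => measurable_pi_apply x
  exact h.comp (hf.prodMk ha)

end Visits

/-! ### Filtrations of the run, moments, and independence of the noise. -/

namespace BAXProcess

variable {Ω 𝕏 : Type*} {m : ℕ}

/-- The initial dataset together with all sequential observations. -/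
def allData (A : BAXProcess Ω 𝕏 m) (ω : Ω) : (Fin m → 𝕏 × ℝ) × (ℕ → 𝕏 × ℝ) :=
  (A.initData ω, fun k => (A.x k ω, A.y k ω))

variable [MeasurableSpace 𝕏]

theorem comap_data_le_succ (A : BAXProcess Ω 𝕏 m) (n : ℕ) :
    MeasurableSpace.comap (A.data n) inferInstance ≤
      MeasurableSpace.comap (A.data (n + 1)) inferInstance := by
  have hg : Measurable fun d : Dataset 𝕏 m (n + 1) => ((d.1, fun k => d.2 k.castSucc) :
      Dataset 𝕏 m n) := by fun_prop
  exact (hg.comp (comap_measurable (A.data (n + 1)))).comap_le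

theorem iSup_comap_data (A : BAXProcess Ω 𝕏 m) :
    ⨆ n, MeasurableSpace.comap (A.data n) inferInstance =
      MeasurableSpace.comap A.allData inferInstance := by
  refine le_antisymm (iSup_le fun n => ?_) ?_
  · have hg : Measurable fun d : (Fin m → 𝕏 × ℝ) × (ℕ → 𝕏 × ℝ) =>
        ((d.1, fun k : Fin n => d.2 k) : Dataset 𝕏 m n) := by fun_prop
    exact (hg.comp (comap_measurable A.allData)).comap_le
  · have hD : ∀ n, Measurable[⨆ n, MeasurableSpace.comap (A.data n) inferInstance] (A.data n) :=
      fun n => (comap_measurable (A.data n)).mono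
        (le_iSup (fun n => MeasurableSpace.comap (A.data n) inferInstance) n) le_rfl
    refine Measurable.comap_le (Measurable.prodMk (measurable_fst.comp (hD 0)) ?_)
    refine @measurable_pi_lambda _ _ _ (_) _ _ fun k => ?_
    -- Observation `k` is the last entry of the dataset of length `k + 1`.
    exact (measurable_pi_apply (Fin.last k)).comp (measurable_snd.comp (hD (k + 1)))

/-- Borel–Cantelli runs along this larger filtration, which contains `f` and the past samples;
`sampling` says that the draw still follows the dataset posterior. -/
theorem comap_prod_history_le_succ (A : BAXProcess Ω 𝕏 m) (n : ℕ) :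
    MeasurableSpace.comap (fun ω => (A.f ω, A.history n ω)) inferInstance ≤
      MeasurableSpace.comap (fun ω => (A.f ω, A.history (n + 1) ω)) inferInstance := by
  have hg : Measurable fun p : (𝕏 → ℝ) × History 𝕏 m (n + 1) =>
      ((p.1, (p.2.1, fun k => p.2.2 k.castSucc)) : (𝕏 → ℝ) × History 𝕏 m n) := by fun_prop
  exact (hg.comp (comap_measurable fun ω => (A.f ω, A.history (n + 1) ω))).comap_le

namespace IsPSBAX

variable [MeasurableSpace Ω] [Finite 𝕏] {A : BAXProcess Ω 𝕏 m}
  {P : Measure Ω} [IsProbabilityMeasure P] {O : (𝕏 → ℝ) → Set 𝕏} {v : ℝ≥0}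

theorem memLp_f (hA : A.IsPSBAX P O v) (x : 𝕏) : MemLp (fun ω => A.f ω x) 2 P :=
  (hA.prior.hasGaussianLaw_eval x).memLp_two

theorem memLp_ε (hA : A.IsPSBAX P O v) (n : ℕ) : MemLp (A.ε n) 2 P := by
  have h : MemLp id 2 (P.map (A.ε n)) := by
    rw [(hA.noise_law n).map_eq]
    exact memLp_id_gaussianReal 2
  exact (memLp_map_measure_iff aestronglyMeasurable_id (hA.measurable_ε n).aemeasurable).1 h

theorem integral_ε (hA : A.IsPSBAX P O v) (n : ℕ) : ∫ ω, A.ε n ω ∂P = 0 := by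
  rw [(hA.noise_law n).integral_eq]
  exact integral_id_gaussianReal

theorem integral_ε_sq (hA : A.IsPSBAX P O v) (n : ℕ) : ∫ ω, A.ε n ω ^ 2 ∂P = v := by
  rw [← variance_of_integral_eq_zero (hA.measurable_ε n).aemeasurable (hA.integral_ε n),
    (hA.noise_law n).variance_eq, variance_id_gaussianReal]

variable [MeasurableSingletonClass 𝕏]

theorem measurable_y (hA : A.IsPSBAX P O v) (n : ℕ) : Measurable (A.y n) :=
  (hA.measurable_f.eval_at (hA.measurable_x n)).add (hA.measurable_ε n)

theorem measurable_initData (hA : A.IsPSBAX P O v) : Measurable A.initData := by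
  refine measurable_pi_iff.2 fun i => ?_
  have hx : Measurable fun ω => A.x₀ ω i := (measurable_pi_apply i).comp hA.measurable_x₀
  exact hx.prodMk ((hA.measurable_f.eval_at hx).add
    ((measurable_pi_apply i).comp hA.measurable_ε₀))

theorem measurable_history (hA : A.IsPSBAX P O v) (n : ℕ) : Measurable (A.history n) :=
  hA.measurable_initData.prodMk (measurable_pi_iff.2 fun k =>
    (hA.measurable_fs k).prodMk ((hA.measurable_x k).prodMk (hA.measurable_y k)))

theorem measurable_data (hA : A.IsPSBAX P O v) (n : ℕ) : Measurable (A.data n) :=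
  History.measurable_toDataset.comp (hA.measurable_history n)

theorem measurable_allData (hA : A.IsPSBAX P O v) : Measurable A.allData :=
  hA.measurable_initData.prodMk (measurable_pi_iff.2 fun k =>
    (hA.measurable_x k).prodMk (hA.measurable_y k))

/-- Past noises are functions of `f` and the history, being the residuals `y - f x`, and the weights
depend only on points already chosen. -/
theorem indepFun_earlyVisit_sum (hA : A.IsPSBAX P O v) (x : 𝕏) (j n : ℕ) :
    IndepFun (fun ω =>
      (∑ k ∈ Finset.range n, earlyVisit (fun i => A.x i ω) x j k * A.ε k ω,
        earlyVisit (fun i => A.x i ω) x j n)) (A.ε n) P := by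
  let Φ : Ω → (𝕏 → ℝ) × History 𝕏 m n × (𝕏 → ℝ) × 𝕏 :=
    fun ω => (A.f ω, A.history n ω, A.fs n ω, A.x n ω)
  have hΦ : Measurable[MeasurableSpace.comap Φ inferInstance] Φ := comap_measurable Φ
  have hf : Measurable[MeasurableSpace.comap Φ inferInstance] A.f := measurable_fst.comp hΦ
  have hpast : ∀ k < n, Measurable[MeasurableSpace.comap Φ inferInstance]
      fun ω => (A.x k ω, A.y k ω) := fun k hk => by
    have hg : Measurable fun p : (𝕏 → ℝ) × History 𝕏 m n × (𝕏 → ℝ) × 𝕏 =>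
        (p.2.1.2 ⟨k, hk⟩).2 := by fun_prop
    exact hg.comp hΦ
  have hx : ∀ k ≤ n, Measurable[MeasurableSpace.comap Φ inferInstance] (A.x k) := fun k hk => by
    rcases hk.lt_or_eq with hk | rfl
    · exact measurable_fst.comp (hpast k hk)
    · exact (measurable_snd.comp (measurable_snd.comp measurable_snd)).comp hΦ
  have hε : ∀ k < n, Measurable[MeasurableSpace.comap Φ inferInstance] (A.ε k) := fun k hk => by
    have h : A.ε k = fun ω => A.y k ω - A.f ω (A.x k ω) := by
      ext ω
      simp [y]
    rw [h]
    exact (measurable_snd.comp (hpast k hk)).sub (hf.eval_at (hx k hk.le))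
  have hm : Measurable[MeasurableSpace.comap Φ inferInstance] fun ω =>
      (∑ k ∈ Finset.range n, earlyVisit (fun i => A.x i ω) x j k * A.ε k ω,
        earlyVisit (fun i => A.x i ω) x j n) := by
    refine Measurable.prodMk (Finset.measurable_sum _ fun k hk => ?_)
      (measurable_earlyVisit hx x j)
    have hk := Finset.mem_range.1 hk
    exact (measurable_earlyVisit (fun i hi => hx i (hi.trans hk.le)) x j).mul (hε k hk)
  have h := (hA.noise_indep n).symm
  rw [IndepFun_iff_Indep] at h ⊢
  exact indep_of_indep_of_le_left h hm.comap_le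

end IsPSBAX

end BAXProcess

/-! ### Properties of the limiting posterior. -/

namespace BAXProcess

namespace IsPSBAX

variable {Ω 𝕏 : Type*} {m : ℕ} [MeasurableSpace Ω] [Finite 𝕏] [MeasurableSpace 𝕏]
  [MeasurableSingletonClass 𝕏] {A : BAXProcess Ω 𝕏 m}
  {P : Measure Ω} [IsProbabilityMeasure P] {O : (𝕏 → ℝ) → Set 𝕏} {v : ℝ≥0}

/-- Averaging the first `j` observations at `x` bounds the limiting posterior variance of `f x`. -/
theorem setLIntegral_variance_le (hA : A.IsPSBAX P O v) (x : 𝕏) {j : ℕ} (hj : 0 < j) (n : ℕ) :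
    ∫⁻ ω in {ω | j ≤ visits (fun k => A.x k ω) x n},
      ENNReal.ofReal Var[fun g : 𝕏 → ℝ => g x; condDistrib A.f A.allData P (A.allData ω)] ∂P ≤
      ENNReal.ofReal (v / j) := by
  have hj0 : (j : ℝ) ≠ 0 := by positivity
  set w : ℕ → Ω → ℝ := fun k ω => earlyVisit (fun i => A.x i ω) x j k with hw
  have hwm : ∀ k, Measurable (w k) := fun k =>
    measurable_earlyVisit (fun i _ => hA.measurable_x i) x j
  have hw1 : ∀ k ω, |w k ω| ≤ 1 := fun k ω => abs_earlyVisit_le _ _ _ _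
  -- The mean of the first `j` observations at `x`, as a function of the data alone.
  let Z : (Fin m → 𝕏 × ℝ) × (ℕ → 𝕏 × ℝ) → ℝ := fun d =>
    (∑ k ∈ Finset.range n, earlyVisit (fun i => (d.2 i).1) x j k * (d.2 k).2) / j
  have hcoord : ∀ i, Measurable fun d : (Fin m → 𝕏 × ℝ) × (ℕ → 𝕏 × ℝ) => (d.2 i).1 :=
    fun i => by fun_prop
  have hZ : Measurable Z := by
    refine (Finset.measurable_sum _ fun k _ => ?_).div_const _
    exact (measurable_earlyVisit (fun i _ => hcoord i) x j).mul (by fun_prop)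
  have hB : MeasurableSet {d : (Fin m → 𝕏 × ℝ) × (ℕ → 𝕏 × ℝ) |
      j ≤ visits (fun i => (d.2 i).1) x n} :=
    measurableSet_le measurable_const (measurable_visits (fun i _ => hcoord i) x)
  have hM := memLp_two_weighted_sum hA.memLp_ε hwm hw1 n
  have hBm : MeasurableSet {ω | j ≤ visits (fun k => A.x k ω) x n} :=
    hA.measurable_allData hB
  calc _ ≤ ∫⁻ ω in {ω | j ≤ visits (fun k => A.x k ω) x n},
        ENNReal.ofReal ((A.f ω x - Z (A.allData ω)) ^ 2) ∂P :=
        setLIntegral_variance_condDistrib_le hA.measurable_allData hA.measurable_f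
          (measurable_pi_apply x) (hA.memLp_f x) hB hZ
    _ = ∫⁻ ω in {ω | j ≤ visits (fun k => A.x k ω) x n},
        ENNReal.ofReal ((∑ k ∈ Finset.range n, w k ω * A.ε k ω) ^ 2 / j ^ 2) ∂P := by
        refine setLIntegral_congr_fun hBm fun ω hω => ?_
        have hsum : ∑ k ∈ Finset.range n, w k ω = j := by
          rw [hw, sum_earlyVisit, min_eq_right hω]
        have hobs : ∑ k ∈ Finset.range n, w k ω * A.y k ω =
            j * A.f ω x + ∑ k ∈ Finset.range n, w k ω * A.ε k ω := by
          rw [← hsum, Finset.sum_mul, ← Finset.sum_add_distrib]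
          refine Finset.sum_congr rfl fun k _ => ?_
          rw [y, mul_add, hw, earlyVisit_mul_eq (fun i => A.x i ω)]
        have hZω : Z (A.allData ω) = (∑ k ∈ Finset.range n, w k ω * A.y k ω) / j := rfl
        rw [hZω, hobs]
        congr 1
        field_simp
        ring
    -- The event depends on past noises, so it is dropped before the second moment is computed.
    _ ≤ ∫⁻ ω, ENNReal.ofReal ((∑ k ∈ Finset.range n, w k ω * A.ε k ω) ^ 2 / j ^ 2) ∂P :=
        setLIntegral_le_lintegral _ _
    _ = ENNReal.ofReal (∫ ω, (∑ k ∈ Finset.range n, w k ω * A.ε k ω) ^ 2 / j ^ 2 ∂P) :=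
        (ofReal_integral_eq_lintegral_ofReal (hM.integrable_sq.div_const _)
          (ae_of_all _ fun _ => by positivity)).symm
    _ ≤ ENNReal.ofReal (v / j) := by
        refine ENNReal.ofReal_le_ofReal ?_
        rw [integral_div, integral_sq_weighted_sum hA.memLp_ε hA.integral_ε hA.integral_ε_sq hwm hw1
          (hA.indepFun_earlyVisit_sum x j) n]
        have hle : ∫ ω, ∑ k ∈ Finset.range n, w k ω ^ 2 ∂P ≤ j := by
          have hle' : ∀ ω, ∑ k ∈ Finset.range n, w k ω ^ 2 ≤ j := fun ω => by
            simp only [hw, earlyVisit_sq, sum_earlyVisit]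
            exact_mod_cast min_le_right _ _
          calc ∫ ω, ∑ k ∈ Finset.range n, w k ω ^ 2 ∂P ≤ ∫ _, (j : ℝ) ∂P :=
                integral_mono_of_nonneg (ae_of_all _ fun ω => by positivity)
                  (integrable_const _) (ae_of_all _ hle')
            _ = j := by simp
        calc (v : ℝ) * (∫ ω, ∑ k ∈ Finset.range n, w k ω ^ 2 ∂P) / (j : ℝ) ^ 2
            ≤ (v : ℝ) * (j : ℝ) / (j : ℝ) ^ 2 := by gcongr
          _ = (v : ℝ) / (j : ℝ) := by field_simp

/-- The value of `f` at a point evaluated infinitely often is learnt exactly. -/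
theorem variance_eq_zero_of_frequently (hA : A.IsPSBAX P O v) (x : 𝕏) :
    ∀ᵐ ω ∂P, (∃ᶠ n in atTop, A.x n ω = x) →
      Var[fun g : 𝕏 → ℝ => g x; condDistrib A.f A.allData P (A.allData ω)] = 0 := by
  set V : Ω → ℝ≥0∞ := fun ω => ENNReal.ofReal
    Var[fun g : 𝕏 → ℝ => g x; condDistrib A.f A.allData P (A.allData ω)] with hV
  let B : ℕ → ℕ → Set Ω := fun j n => {ω | j ≤ visits (fun k => A.x k ω) x n}
  have hB : ∀ j n, MeasurableSet (B j n) := fun j n =>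
    measurableSet_le measurable_const (measurable_visits (fun i _ => hA.measurable_x i) x)
  have hBmono : ∀ j, Monotone (B j) := fun j n n' h ω hω =>
    le_trans hω (monotone_visits _ x h)
  have hU : ∀ j > 0, ∫⁻ ω in ⋃ n, B j n, V ω ∂P ≤ ENNReal.ofReal (v / j) := fun j hj => by
    rw [setLIntegral_iUnion_of_directed V (hBmono j).directed_le]
    exact iSup_le fun n => hA.setLIntegral_variance_le x hj n
  have hzero : ∫⁻ ω in ⋂ j, ⋃ n, B j n, V ω ∂P = 0 := by
    have hlim : Tendsto (fun j : ℕ => ENNReal.ofReal ((v : ℝ) / j)) atTop (nhds 0) := by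
      rw [← ENNReal.ofReal_zero]
      exact ENNReal.tendsto_ofReal (tendsto_const_div_atTop_nhds_zero_nat _)
    refine le_antisymm (ge_of_tendsto hlim ?_) zero_le
    -- At `j = 0` the quotient `v / j` is 0 by convention and gives no valid bound.
    filter_upwards [eventually_gt_atTop 0] with j hj
    exact (lintegral_mono_set (Set.iInter_subset _ j)).trans (hU j hj)
  have hVm : AEMeasurable V P := (aemeasurable_variance_condDistrib hA.measurable_allData
    hA.measurable_f (measurable_pi_apply x) (hA.memLp_f x)).ennreal_ofReal
  have hI : MeasurableSet (⋂ j, ⋃ n, B j n) :=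
    MeasurableSet.iInter fun j => MeasurableSet.iUnion fun n => hB j n
  rw [lintegral_eq_zero_iff' hVm.restrict, EventuallyEq, ae_restrict_iff' hI] at hzero
  filter_upwards [hzero] with ω hω hfreq
  have h := hω (Set.mem_iInter.2 fun j => Set.mem_iUnion.2 (exists_le_visits hfreq j))
  exact le_antisymm (ENNReal.ofReal_eq_zero.1 h) (variance_nonneg _ _)

/-- The probability that `f ∈ s` while the limiting probability of `s` vanishes is the integral of
that probability over its zero set. -/
theorem ae_limit_prob_ne_zero (hA : A.IsPSBAX P O v) {s : Set (𝕏 → ℝ)} (hs : MeasurableSet s) :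
    ∀ᵐ ω ∂P, A.f ω ∈ s → (condDistrib A.f A.allData P (A.allData ω)).real s ≠ 0 := by
  have ht : MeasurableSet {d | condDistrib A.f A.allData P d s = 0} :=
    Kernel.measurable_coe _ hs (measurableSet_singleton 0)
  have h := setLIntegral_preimage_condDistrib hA.measurable_allData
    (hA.measurable_f.aemeasurable (μ := P)) hs ht
  rw [setLIntegral_eq_zero (hA.measurable_allData ht) (fun ω hω => hω)] at h
  filter_upwards [measure_eq_zero_iff_ae_notMem.1 h.symm] with ω hω hf h0
  exact hω ⟨(measureReal_eq_zero_iff).1 h0, hf⟩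

/-- Otherwise Borel–Cantelli sends the posterior probabilities of `s` to zero, against their Lévy
limit. -/
theorem frequently_sample (hA : A.IsPSBAX P O v) {s : Set (𝕏 → ℝ)} (hs : MeasurableSet s) :
    ∀ᵐ ω ∂P, (condDistrib A.f A.allData P (A.allData ω)).real s ≠ 0 →
      ∃ᶠ n in atTop, A.fs n ω ∈ s := by
  have hlast : ∀ n, Measurable[MeasurableSpace.comap
      (fun ω => (A.f ω, A.history (n + 1) ω)) inferInstance] (A.fs n) := fun n => by
    have hg : Measurable fun p : (𝕏 → ℝ) × History 𝕏 m (n + 1) => (p.2.2 (Fin.last n)).1 := by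
      fun_prop
    exact hg.comp (comap_measurable fun ω => (A.f ω, A.history (n + 1) ω))
  filter_upwards [tendsto_condDistrib_apply hA.measurable_allData hA.measurable_data
      hA.measurable_f (monotone_nat_of_le_succ A.comap_data_le_succ) A.iSup_comap_data hs,
    tendsto_zero_of_eventually_notMem
      (fun n => hA.measurable_f.prodMk (hA.measurable_history n)) hA.measurable_fs
      (monotone_nat_of_le_succ A.comap_prod_history_le_succ) hlast hA.sampling hs]
    with ω h1 h2 hne
  by_contra hcon
  exact hne (tendsto_nhds_unique h1 (h2 (not_frequently.1 hcon)))

end IsPSBAX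

end BAXProcess

/-! ### Pathwise argument and conclusion. -/

/-- By pigeonhole one `z` is the maximiser at infinitely many times when `x ∈ S n`; the inequality
at those times passes to the limit. -/
theorem variance_eq_zero_of_frequently_mem {𝕏 : Type*} [Finite 𝕏] {S : ℕ → Set 𝕏} {a : ℕ → 𝕏}
    {V : ℕ → 𝕏 → ℝ} {W : 𝕏 → ℝ} (hW : ∀ x, 0 ≤ W x)
    (hlim : ∀ x, Tendsto (fun n => V n x) atTop (nhds (W x)))
    (ha : ∀ x, (∃ᶠ n in atTop, a n = x) → W x = 0)
    (hmax : ∀ n, (S n).Nonempty → ∀ x ∈ S n, √(V n x) ≤ √(V n (a n)))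
    {x : 𝕏} (hx : ∃ᶠ n in atTop, x ∈ S n) : W x = 0 := by
  obtain ⟨z, hz⟩ : ∃ z, ∃ᶠ n in atTop, x ∈ S n ∧ a n = z := by
    by_contra hcon
    rw [not_exists] at hcon
    have hcon' : ∀ᶠ n in atTop, ∀ z, ¬(x ∈ S n ∧ a n = z) :=
      eventually_all.2 fun z => not_frequently.1 (hcon z)
    exact hx (hcon'.mono fun n hn hxn => hn (a n) ⟨hxn, rfl⟩)
  have hWz : W z = 0 := ha z (hz.mono fun n hn => hn.2)
  have hle : √(W x) ≤ √(W z) := by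
    refine le_of_tendsto_of_tendsto_of_frequently ((hlim x).sqrt) ((hlim z).sqrt) ?_
    exact hz.mono fun n hn => hn.2 ▸ hmax n ⟨x, hn.1⟩ x hn.1
  rw [hWz, Real.sqrt_zero] at hle
  exact le_antisymm (Real.sqrt_eq_zero'.1 (le_antisymm hle (Real.sqrt_nonneg _))) (hW x)

/-- If `μ` charges only target sets consisting of points where it has no variance, then it charges
only one target set. -/
theorem ComplementIndependent.target_eq {𝕏 : Type*} [Finite 𝕏] {O : (𝕏 → ℝ) → Set 𝕏}
    (hO : ComplementIndependent O) {μ : Measure (𝕏 → ℝ)} [IsProbabilityMeasure μ]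
    (hL : ∀ x, MemLp (fun g : 𝕏 → ℝ => g x) 2 μ)
    (hV : ∀ Y, μ.real {g | O g = Y} ≠ 0 → ∀ x ∈ Y, Var[fun g : 𝕏 → ℝ => g x; μ] = 0)
    {Y Y' : Set 𝕏} (hY : μ.real {g | O g = Y} ≠ 0) (hY' : μ.real {g | O g = Y'} ≠ 0) :
    Y = Y' := by
  have hae : ∀ᵐ g ∂μ, ∀ x, Var[fun g : 𝕏 → ℝ => g x; μ] = 0 → g x = μ[fun g : 𝕏 → ℝ => g x] := by
    refine ae_all_iff.2 fun x => ?_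
    by_cases h : Var[fun g : 𝕏 → ℝ => g x; μ] = 0
    · filter_upwards [ae_eq_integral_of_variance_eq_zero (hL x) h] with g hg _ using hg
    · exact ae_of_all _ fun g hg => absurd hg h
  have hex : ∀ Y, μ.real {g | O g = Y} ≠ 0 → ∃ g, O g = Y ∧
      ∀ x, Var[fun g : 𝕏 → ℝ => g x; μ] = 0 → g x = μ[fun g : 𝕏 → ℝ => g x] := fun Y hY => by
    -- Positive mass meets the almost sure event, which yields an actual function.
    have hfreq : ∃ᵐ g ∂μ, O g = Y := fun hcon =>
      hY ((measureReal_eq_zero_iff).2 (measure_eq_zero_iff_ae_notMem.2 hcon))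
    exact (hfreq.and_eventually hae).exists
  obtain ⟨g, rfl, hg⟩ := hex Y hY
  obtain ⟨g', rfl, hg'⟩ := hex Y' hY'
  refine hO g g' ⟨O g ∪ O g', subset_rfl, fun x hx => ?_⟩
  have hx0 : Var[fun g : 𝕏 → ℝ => g x; μ] = 0 := hx.elim (hV _ hY x) (hV _ hY' x)
  rw [hg x hx0, hg' x hx0]

theorem corollary1 {Ω 𝕏 : Type*} [MeasurableSpace Ω] [Finite 𝕏] [MeasurableSpace 𝕏]
    [MeasurableSingletonClass 𝕏] (P : Measure Ω) [IsProbabilityMeasure P]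
    (O : (𝕏 → ℝ) → Set 𝕏) (hO_meas : ∀ X : Set 𝕏, MeasurableSet {g : 𝕏 → ℝ | O g = X})
    (hO : ComplementIndependent O)
    (m : ℕ) (v : ℝ≥0) (A : BAXProcess Ω 𝕏 m) (hA : A.IsPSBAX P O v)
    (T : ℕ → Ω → Set 𝕏)
    (hT : ∀ n, ∀ᵐ ω ∂P, ∀ X : Set 𝕏,
      A.targetProb P O n ω X ≤ A.targetProb P O n ω (T n ω)) :
    ∀ᵐ ω ∂P, ∀ᶠ n in atTop, T n ω = O (A.f ω) := by
  have hmono := monotone_nat_of_le_succ A.comap_data_le_succ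
  filter_upwards [ae_all_iff.2 hT, ae_all_iff.2 hA.argmax,
    ae_all_iff.2 fun Y => tendsto_condDistrib_apply (P := P) hA.measurable_allData
      hA.measurable_data hA.measurable_f hmono A.iSup_comap_data (hO_meas Y),
    ae_all_iff.2 fun x => tendsto_variance_condDistrib hA.measurable_allData
      hA.measurable_data hA.measurable_f hmono A.iSup_comap_data (measurable_pi_apply x)
      (hA.memLp_f x),
    ae_all_iff.2 fun x => ae_memLp_condDistrib hA.measurable_allData hA.measurable_f
      (measurable_pi_apply x) (hA.memLp_f x),
    ae_all_iff.2 hA.variance_eq_zero_of_frequently,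
    ae_all_iff.2 fun Y => hA.ae_limit_prob_ne_zero (hO_meas Y),
    ae_all_iff.2 fun Y => hA.frequently_sample (hO_meas Y)]
    with ω hTω hmax hprob hvar hL hvisit hpos hsample
  set κ := condDistrib A.f A.allData P (A.allData ω) with hκ
  have hV : ∀ Y, κ.real {g | O g = Y} ≠ 0 → ∀ x ∈ Y, Var[fun g : 𝕏 → ℝ => g x; κ] = 0 :=
    fun Y hY x hx => variance_eq_zero_of_frequently_mem (S := fun n => O (A.fs n ω))
      (a := fun n => A.x n ω) (fun x => variance_nonneg _ _) hvar hvisit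
      (fun n hn => (hmax n hn).2)
      ((hsample Y hY).mono fun n (hn : O (A.fs n ω) = Y) => hn ▸ hx)
  have hf : κ.real {g | O g = O (A.f ω)} ≠ 0 := hpos _ rfl
  have hlt : ∀ Y, Y ≠ O (A.f ω) → ∀ᶠ n in atTop,
      A.targetProb P O n ω Y < A.targetProb P O n ω (O (A.f ω)) := fun Y hY => by
    have hY0 : κ.real {g | O g = Y} = 0 := by
      by_contra h
      exact hY (hO.target_eq hL hV h hf)
    have h := (hprob Y).eventually_lt (hprob (O (A.f ω)))
      (hY0 ▸ lt_of_le_of_ne measureReal_nonneg hf.symm)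
    filter_upwards [h] with n hn
    exact (ENNReal.toReal_lt_toReal (measure_ne_top _ _) (measure_ne_top _ _)).1 hn
  -- Finitely many subsets of `𝕏` allow one threshold for all `Y`.
  have hall : ∀ᶠ n in atTop, ∀ Y, Y ≠ O (A.f ω) →
      A.targetProb P O n ω Y < A.targetProb P O n ω (O (A.f ω)) :=
    eventually_all.2 fun Y => by
      by_cases hY : Y = O (A.f ω)
      · exact Eventually.of_forall fun n h => absurd hY h
      · exact (hlt Y hY).mono fun n hn _ => hn
  filter_upwards [hall] with n hn
  by_contra hne
  exact absurd (hTω n (O (A.f ω))) (not_le.2 (hn _ hne))
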